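/- Let $\mathbb{O}$ be the algebra of octonions, with conjugation $x\mapsto\bar x$, and identify $\mathbb{R}$ with the real octonions. A regular octonionic polynomial is a polynomial $f(w)=\sum_i w^i a_i$ with right coefficients $a_i\in\mathbb{O}$; it has the zero set $V(f)=\{\alpha\in\mathbb{O} : \sum_i\alpha^i a_i=0\}$. The product of $f=\sum_i w^i a_i$ and $g=\sum_j w^j b_j$ is $f*g=\sum_k w^k\big(\sum_{i+j=k}a_ib_j\big)$, and $g\mid f$ means that $f=g*h$ for some regular octonionic polynomial $h$. Put $\bar f=\sum_i w^i\bar a_i$, $N(f)=f*\bar f$, and, for $\alpha\in\mathbb{O}$, $\Delta_\alpha(w)=N(w-\alpha)=w^2-w(\alpha+\bar\alpha)+|\alpha|^2$ and $\mathbb{S}_\alpha=\{\mathrm{Re}(\alpha)+|\mathrm{Im}(\alpha)|\,I : I\in\mathbb{O},\ I^2=-1\}$. A non-real $\alpha\in V(f)$ is called a spherical zero of $f$ if $\mathbb{S}_\alpha\subseteq V(f)$, and an isolated zero of $f$ otherwise. A zero $\alpha\in V(f)$ has multiplicity $s\in\mathbb{N}$ if $\Delta_\alpha^s\mid N(f)$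 and $\Delta_\alpha^{s+1}\nmid N(f)$. Let $f(w)=\sum_{i=0}^n w^i a_i$ be a regular octonionic polynomial of degree $n>0$ (so $a_n\neq0$). Then: (1) If $a_1,\dots,a_n$ are real and $a_0$ is non-real, then $f$ has only isolated zeros (every $\alpha\in V(f)$ is non-real and is an isolated zero). (2) If $a_2,\dots,a_n$ are real and $a_0$ or $a_1$ is non-real, then $f$ has no spherical zeros. In either case, the set $V(f)$ is finite, every $\alpha\in V(f)$ has a multiplicity $m_f(\alpha)$, and $V(f)$ contains exactly $n$ elements counted with their multiplicities, i.e. $\sum_{\alpha\in V(f)}m_f(\alpha)=n$. -/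

import Mathlib

/-- The real algebra of octonions, obtained from the quaternions by the Cayley-Dickson process:
the pair `⟨x₁, x₂⟩` stands for `x₁ + x₂ k`. -/
@[ext]
structure Octonion : Type where
  fst : Quaternion ℝ
  snd : Quaternion ℝ

namespace Octonion

noncomputable section

instance : Zero Octonion := ⟨⟨0, 0⟩⟩
instance : One Octonion := ⟨⟨1, 0⟩⟩
instance : Add Octonion := ⟨fun x y => ⟨x.fst + y.fst, x.snd + y.snd⟩⟩
instance : Neg Octonion := ⟨fun x => ⟨-x.fst, -x.snd⟩⟩
instance : Sub Octonion := ⟨fun x y => ⟨x.fst - y.fst, x.snd - y.snd⟩⟩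
instance : SMul ℕ Octonion := ⟨fun r x => ⟨r • x.fst, r • x.snd⟩⟩
instance : SMul ℤ Octonion := ⟨fun r x => ⟨r • x.fst, r • x.snd⟩⟩
instance : SMul ℝ Octonion := ⟨fun r x => ⟨r • x.fst, r • x.snd⟩⟩

/-- `(x₁ + x₂ k)(y₁ + y₂ k) = x₁ y₁ - ȳ₂ x₂ + (x₂ ȳ₁ + y₂ x₁) k`. -/
instance : Mul Octonion :=
  ⟨fun x y => ⟨x.fst * y.fst - star y.snd * x.snd, x.snd * star y.fst + y.snd * x.fst⟩⟩

/-- The conjugation `x₁ + x₂ k ↦ x̄₁ - x₂ k`. -/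
instance : Star Octonion := ⟨fun x => ⟨star x.fst, -x.snd⟩⟩

/-- Powers `x ^ 0 = 1`, `x ^ (n + 1) = x ^ n * x` (octonions are power-associative). -/
instance : Pow Octonion ℕ := ⟨fun x n => npowRec n x⟩

@[simp] theorem fst_zero : (0 : Octonion).fst = 0 := rfl
@[simp] theorem snd_zero : (0 : Octonion).snd = 0 := rfl
@[simp] theorem fst_one : (1 : Octonion).fst = 1 := rfl
@[simp] theorem snd_one : (1 : Octonion).snd = 0 := rfl
@[simp] theorem fst_add (x y : Octonion) : (x + y).fst = x.fst + y.fst := rfl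
@[simp] theorem snd_add (x y : Octonion) : (x + y).snd = x.snd + y.snd := rfl
@[simp] theorem fst_neg (x : Octonion) : (-x).fst = -x.fst := rfl
@[simp] theorem snd_neg (x : Octonion) : (-x).snd = -x.snd := rfl
@[simp] theorem fst_sub (x y : Octonion) : (x - y).fst = x.fst - y.fst := rfl
@[simp] theorem snd_sub (x y : Octonion) : (x - y).snd = x.snd - y.snd := rfl
@[simp] theorem fst_smul (r : ℝ) (x : Octonion) : (r • x).fst = r • x.fst := rfl
@[simp] theorem snd_smul (r : ℝ) (x : Octonion) : (r • x).snd = r • x.snd := rfl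
@[simp] theorem fst_mul (x y : Octonion) :
    (x * y).fst = x.fst * y.fst - star y.snd * x.snd := rfl
@[simp] theorem snd_mul (x y : Octonion) :
    (x * y).snd = x.snd * star y.fst + y.snd * x.fst := rfl
@[simp] theorem fst_star (x : Octonion) : (star x).fst = star x.fst := rfl
@[simp] theorem snd_star (x : Octonion) : (star x).snd = -x.snd := rfl

/-- The underlying pair of quaternions. -/
def toProd (x : Octonion) : Quaternion ℝ × Quaternion ℝ := (x.fst, x.snd)

theorem toProd_injective : Function.Injective toProd := fun _ _ h =>
  Octonion.ext (congrArg Prod.fst h) (congrArg Prod.snd h)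

instance : AddCommGroup Octonion :=
  toProd_injective.addCommGroup toProd rfl (fun _ _ => rfl) (fun _ => rfl) (fun _ _ => rfl)
    (fun _ _ => rfl) (fun _ _ => rfl)

instance : NonUnitalNonAssocRing Octonion where
  left_distrib x y z := by
    ext1
    · simp only [fst_mul, fst_add, snd_add, star_add, mul_add, add_mul]; abel
    · simp only [snd_mul, fst_add, snd_add, star_add, mul_add, add_mul]; abel
  right_distrib x y z := by
    ext1
    · simp only [fst_mul, fst_add, snd_add, mul_add, add_mul]; abel
    · simp only [snd_mul, fst_add, snd_add, mul_add, add_mul]; abel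
  zero_mul x := by ext1 <;> simp
  mul_zero x := by ext1 <;> simp

instance : NonAssocRing Octonion where
  one_mul x := by ext1 <;> simp
  mul_one x := by ext1 <;> simp

instance : Module ℝ Octonion where
  one_smul x := by ext1 <;> simp
  mul_smul r s x := by ext1 <;> simp [mul_smul]
  smul_zero r := by ext1 <;> simp
  smul_add r x y := by ext1 <;> simp
  add_smul r s x := by ext1 <;> simp [add_smul]
  zero_smul x := by ext1 <;> simp

/-- The real part of an octonion. -/
def re (x : Octonion) : ℝ := x.fst.re

/-- A real number, viewed as an octonion. -/
def ofReal (r : ℝ) : Octonion := r • (1 : Octonion)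

/-- The imaginary part `x - Re x`. -/
def im (x : Octonion) : Octonion := x - ofReal x.re

/-- The Euclidean norm of an octonion, where `𝕆 = ℍ ⊕ ℍ k = ℝ⁸`. -/
def abs (x : Octonion) : ℝ := Real.sqrt (‖x.fst‖ ^ 2 + ‖x.snd‖ ^ 2)

/-- The octonion `x` is real. -/
def IsReal (x : Octonion) : Prop := ∃ r : ℝ, x = ofReal r

/-- The set of imaginary units. -/
def imaginaryUnits : Set Octonion := {I | I * I = -1}

/-- The conjugacy class `{Re α + |Im α| I : I an imaginary unit}` of `α`. -/
def conjClass (α : Octonion) : Set Octonion :=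
  {β | ∃ I ∈ imaginaryUnits, β = ofReal α.re + abs α.im • I}

end

end Octonion

/-- Regular octonionic polynomials `∑ wⁱ aᵢ` in the variable `w`, given by their finitely supported
sequences of (right) octonionic coefficients `aᵢ`. -/
abbrev OctPoly : Type := ℕ →₀ Octonion

namespace OctPoly

noncomputable section

/-- The coefficient `aᵢ` of `wⁱ`. -/
def coeff (f : OctPoly) (i : ℕ) : Octonion := f i

/-- The monomial `wⁱ a`. -/
def monomial (i : ℕ) (a : Octonion) : OctPoly := Finsupp.single i a

/-- The star product of polynomials, in which the variable commutes with the coefficients: the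
coefficient of `wᵏ` in `mul f g` is `∑_{i+j=k} aᵢ bⱼ`. (Not the pointwise product of finitely
supported functions, which is not used here.) -/
def mul (f g : OctPoly) : OctPoly :=
  f.sum fun i a => g.sum fun j b => monomial (i + j) (a * b)

/-- Powers for the star product: the `0`-th power is the constant `1`, and the `(n + 1)`-st power
is the `n`-th power times `f`. -/
def pow (f : OctPoly) : ℕ → OctPoly
  | 0 => monomial 0 1
  | n + 1 => mul (pow f n) f

/-- The value `∑ wⁱ aᵢ` of the polynomial at `w`. -/
def eval (w : Octonion) (f : OctPoly) : Octonion := f.sum fun i a => w ^ i * a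

/-- `f` has degree `n`. -/
def HasDegree (f : OctPoly) (n : ℕ) : Prop := f.coeff n ≠ 0 ∧ ∀ i, n < i → f.coeff i = 0

/-- The polynomial `f̄` whose coefficients are the conjugates of those of `f`. -/
def conj (f : OctPoly) : OctPoly :=
  f.mapRange (star : Octonion → Octonion) (by ext1 <;> simp)

/-- The normal polynomial `N(f)`, the star product of `f` and `f̄`. -/
def normal (f : OctPoly) : OctPoly := mul f f.conj

/-- The characteristic polynomial `Δ_α = N(w - α)` of `α`. -/
def charPoly (α : Octonion) : OctPoly := normal (monomial 1 1 - monomial 0 α)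

/-- `g` divides `f` for the star product. -/
def Divides (g f : OctPoly) : Prop := ∃ h : OctPoly, f = mul g h

/-- The zero set `V(f)`. -/
def zeroSet (f : OctPoly) : Set Octonion := {w | f.eval w = 0}

/-- A spherical zero: a non-real zero whose whole conjugacy class consists of zeros. -/
def IsSphericalZero (f : OctPoly) (α : Octonion) : Prop :=
  α ∈ f.zeroSet ∧ ¬ α.IsReal ∧ α.conjClass ⊆ f.zeroSet

/-- An isolated zero: a zero that is neither real nor spherical. -/
def IsIsolatedZero (f : OctPoly) (α : Octonion) : Prop :=
  α ∈ f.zeroSet ∧ ¬ α.IsReal ∧ ¬ f.IsSphericalZero α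

/-- `α` is a zero of `f` of multiplicity `s`. -/
def IsZeroOfMultiplicity (f : OctPoly) (α : Octonion) (s : ℕ) : Prop :=
  α ∈ f.zeroSet ∧ Divides (pow (charPoly α) s) f.normal ∧
    ¬ Divides (pow (charPoly α) (s + 1)) f.normal

end

end OctPoly

/-! Every octonion `x` satisfies `x² = t x - d` with `t = 2 Re x` and `d = |x|²`, so on the sphere
of all `x` with given `t`, `d` the value of `f` is `A + x B`, where `A + w B` is the remainder of
`f` modulo `w² - t w + d`. A complex `z` satisfying the same equation has `N(f)(z) = |A|² + 2⟨A, B⟩z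
+ |B|²z²` (`aeval_realNormal`). If `a₂, …, aₙ` are real, then `Im A = Im a₀` and `Im B = Im a₁`, so
under either hypothesis `A` and `B` never both vanish. As there are no zero divisors, each sphere
then holds at most one zero, necessarily `-A B⁻¹`, and it holds one exactly when its point in the
closed upper half-plane is a root of `N(f)`. Thus `V(f)` is in bijection with those roots. Finally
`N(f)` is a real polynomial of degree `2n` equal to `|f(x)|²` on the real line, so it is a positive
constant times a product of quadratics `Δ_α`, and counting degrees gives `n`. -/

namespace Octonion

/-! ### Octonion arithmetic: norm, inner product, conjugation -/

/-- The squared Euclidean norm of an octonion. -/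
noncomputable def normSq (x : Octonion) : ℝ := (x * star x).re

@[simp] theorem quaternion_re_one : (1 : Quaternion ℝ).re = 1 := rfl
@[simp] theorem quaternion_imI_one : (1 : Quaternion ℝ).imI = 0 := rfl
@[simp] theorem quaternion_imJ_one : (1 : Quaternion ℝ).imJ = 0 := rfl
@[simp] theorem quaternion_imK_one : (1 : Quaternion ℝ).imK = 0 := rfl
@[simp] theorem quaternion_re_zero : (0 : Quaternion ℝ).re = 0 := rfl
@[simp] theorem quaternion_imI_zero : (0 : Quaternion ℝ).imI = 0 := rfl
@[simp] theorem quaternion_imJ_zero : (0 : Quaternion ℝ).imJ = 0 := rfl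
@[simp] theorem quaternion_imK_zero : (0 : Quaternion ℝ).imK = 0 := rfl

@[simp] theorem re_add (x y : Octonion) : (x + y).re = x.re + y.re := rfl
@[simp] theorem re_neg (x : Octonion) : (-x).re = -x.re := rfl
@[simp] theorem re_smul (r : ℝ) (x : Octonion) : (r • x).re = r * x.re := rfl
@[simp] theorem re_zero : (0 : Octonion).re = 0 := rfl
@[simp] theorem re_ofReal (r : ℝ) : (ofReal r).re = r := by simp [ofReal, re]

/-- The real part as a linear map. -/
noncomputable def reₗ : Octonion →ₗ[ℝ] ℝ where
  toFun := re
  map_add' _ _ := rfl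
  map_smul' _ _ := rfl

@[simp] theorem reₗ_apply (x : Octonion) : reₗ x = x.re := rfl

theorem smul_mul (r : ℝ) (x y : Octonion) : (r • x) * y = r • (x * y) := by
  ext1 <;> simp [smul_sub, smul_add]

theorem mul_smul' (r : ℝ) (x y : Octonion) : x * (r • y) = r • (x * y) := by
  ext1 <;> simp [smul_sub, smul_add]

theorem star_add' (x y : Octonion) : star (x + y) = star x + star y := by
  ext1 <;> simp [add_comm]

theorem star_smul' (r : ℝ) (x : Octonion) : star (r • x) = r • star x := by
  ext1 <;> simp

theorem star_star' (x : Octonion) : star (star x) = x := by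
  ext1 <;> simp

theorem star_mul' (x y : Octonion) : star (x * y) = star y * star x := by
  ext1 <;> simp [sub_eq_add_neg, add_comm]

theorem ofReal_mul (r : ℝ) (x : Octonion) : ofReal r * x = r • x := by
  rw [ofReal, smul_mul, one_mul]

/-- The real inner product `Re (x ȳ)`, as a bilinear map. -/
noncomputable def innerₗ : Octonion →ₗ[ℝ] Octonion →ₗ[ℝ] ℝ :=
  LinearMap.mk₂ ℝ (fun x y => (x * star y).re)
    (fun x y z => by simp [add_mul]) (fun r x y => by simp [smul_mul])
    (fun x y z => by simp [star_add', mul_add]) (fun r x y => by simp [star_smul', mul_smul'])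

theorem innerₗ_apply (x y : Octonion) : innerₗ x y = (x * star y).re := rfl

theorem innerₗ_self (x : Octonion) : innerₗ x x = x.normSq := rfl

theorem normSq_eq (x : Octonion) : x.normSq =
    x.fst.re ^ 2 + x.fst.imI ^ 2 + x.fst.imJ ^ 2 + x.fst.imK ^ 2 +
    (x.snd.re ^ 2 + x.snd.imI ^ 2 + x.snd.imJ ^ 2 + x.snd.imK ^ 2) := by
  simp [normSq, re]; ring

theorem innerₗ_comm (x y : Octonion) : innerₗ x y = innerₗ y x := by
  simp [innerₗ_apply, re]; ring

theorem normSq_nonneg (x : Octonion) : 0 ≤ x.normSq := by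
  rw [normSq_eq]; positivity

theorem normSq_eq_zero {x : Octonion} : x.normSq = 0 ↔ x = 0 := by
  refine ⟨fun h => ?_, fun h => by simp [h, normSq]⟩
  rw [normSq_eq] at h
  ext <;> simp <;> nlinarith [sq_nonneg x.fst.re, sq_nonneg x.fst.imI, sq_nonneg x.fst.imJ,
    sq_nonneg x.fst.imK, sq_nonneg x.snd.re, sq_nonneg x.snd.imI, sq_nonneg x.snd.imJ,
    sq_nonneg x.snd.imK]

theorem normSq_star (x : Octonion) : (star x).normSq = x.normSq := by
  simp [normSq_eq]

theorem re_star (x : Octonion) : (star x).re = x.re := by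
  simp [re]

theorem normSq_ofReal (r : ℝ) : (ofReal r).normSq = r ^ 2 := by
  simp [normSq_eq, ofReal]

theorem normSq_smul (r : ℝ) (x : Octonion) : (r • x).normSq = r ^ 2 * x.normSq := by
  simp [normSq_eq]; ring

theorem normSq_mul (x y : Octonion) : (x * y).normSq = x.normSq * y.normSq := by
  simp [normSq_eq]; ring

theorem normSq_neg (x : Octonion) : (-x).normSq = x.normSq := by
  simp [normSq_eq]

theorem mul_self_eq (x : Octonion) : x * x = (2 * x.re) • x - ofReal x.normSq := by
  rw [normSq_eq]
  ext <;> simp [re, ofReal] <;> ring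

theorem mul_star_self (x : Octonion) : x * star x = ofReal x.normSq := by
  rw [normSq_eq]
  ext <;> simp [ofReal] <;> ring

theorem add_star_self (x : Octonion) : x + star x = ofReal (2 * x.re) := by
  ext <;> simp [ofReal, re] ; ring

/-- The trace of associativity left by right alternativity; it is what allows division by `y` on the
right. -/
theorem mul_star_mul_cancel (x y : Octonion) : (x * star y) * y = y.normSq • x := by
  rw [normSq_eq]
  ext <;> simp <;> ring

theorem mul_mul_star_cancel (x y : Octonion) : (x * y) * star y = y.normSq • x := by
  rw [normSq_eq]
  ext <;> simp <;> ring

theorem eq_ofReal_re_of_star_eq {x : Octonion} (h : star x = x) : x = ofReal x.re := by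
  have h1 := add_star_self x
  rw [h, ofReal, mul_smul, two_smul] at h1
  have h2 : (2 : ℝ) • x = (2 : ℝ) • ofReal x.re := by rw [two_smul, two_smul]; exact h1
  exact smul_right_injective _ (two_ne_zero) h2

theorem IsReal.eq_ofReal_re {x : Octonion} (h : x.IsReal) : x = ofReal x.re := by
  obtain ⟨r, rfl⟩ := h
  rw [re_ofReal]

theorem eq_zero_or_eq_zero {x y : Octonion} (h : x * y = 0) : x = 0 ∨ y = 0 := by
  rw [← normSq_eq_zero, ← normSq_eq_zero (x := y), ← mul_eq_zero, ← normSq_mul, h]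
  simp [normSq]

theorem abs_sq (x : Octonion) : abs x ^ 2 = x.normSq := by
  rw [abs, Real.sq_sqrt (by positivity), normSq_eq, pow_two, pow_two, ← Quaternion.normSq_eq_norm_mul_self,
    ← Quaternion.normSq_eq_norm_mul_self, Quaternion.normSq_def', Quaternion.normSq_def']

theorem normSq_im (x : Octonion) : x.im.normSq = x.normSq - x.re ^ 2 := by
  simp [im, normSq_eq, ofReal, re]; ring

theorem re_im (x : Octonion) : x.im.re = 0 := by
  simp [im, re, ofReal]

theorem eq_ofReal_add_im (x : Octonion) : x = ofReal x.re + x.im := by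
  simp [im]

/-- Supplies a second point of the sphere of a non-real `x`; the imaginary unit is `-Im x / |Im x|`.
-/
theorem star_mem_conjClass {x : Octonion} (h : ¬ x.IsReal) : star x ∈ x.conjClass := by
  have h0 : x.im ≠ 0 := fun h0 => h ⟨x.re, by simpa [h0] using eq_ofReal_add_im x⟩
  have h1 : abs x.im ≠ 0 := fun h1 => h0 <| by
    rw [← normSq_eq_zero, ← abs_sq, h1]; norm_num
  refine ⟨-((abs x.im)⁻¹ • x.im), ?_, ?_⟩
  · change _ * _ = _
    rw [mul_self_eq, normSq_neg, normSq_smul, ← abs_sq, re_neg, re_smul, re_im]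
    rw [← mul_pow, inv_mul_cancel₀ h1]
    simp [ofReal]
  · rw [smul_neg, smul_smul, mul_inv_cancel₀ h1, one_smul]
    have := add_star_self x
    rw [im, eq_sub_of_add_eq' this, mul_comm, ofReal, mul_smul, ofReal]
    rw [two_smul, smul_add]
    abel

theorem pow_zero' (x : Octonion) : x ^ 0 = 1 := rfl

theorem pow_succ' (x : Octonion) (n : ℕ) : x ^ (n + 1) = x ^ n * x := rfl

end Octonion

/-! ### Reduction modulo a real quadratic -/

/-- The real coefficients `(u, v)` such that `xⁱ = u + v x` whenever `x ^ 2 = t x - d`. -/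
def quadraticPow {R : Type*} [CommRing R] (t d : R) : ℕ → R × R
  | 0 => (1, 0)
  | i + 1 => (-d * (quadraticPow t d i).2,
      (quadraticPow t d i).1 + t * (quadraticPow t d i).2)

/-- The same real coefficients serve complex numbers and octonions, which links roots of `N(f)` to
zeros of `f`. -/
theorem pow_eq_quadraticPow {z : ℂ} {t d : ℝ} (h : z ^ 2 = t * z - d) (i : ℕ) :
    z ^ i = (quadraticPow t d i).1 + (quadraticPow t d i).2 * z := by
  induction i with
  | zero => simp [quadraticPow]
  | succ i ih =>
    rw [pow_succ, ih]
    simp only [quadraticPow]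
    push_cast
    linear_combination ((quadraticPow t d i).2 : ℂ) * h

theorem Octonion.pow_eq_quadraticPow (x : Octonion) (i : ℕ) :
    x ^ i = ofReal (quadraticPow (2 * x.re) x.normSq i).1 +
      (quadraticPow (2 * x.re) x.normSq i).2 • x := by
  induction i with
  | zero => simp [quadraticPow, pow_zero', ofReal]
  | succ i ih =>
    rw [pow_succ', ih, add_mul, ofReal_mul, smul_mul, mul_self_eq]
    simp only [quadraticPow, ofReal]
    module

namespace OctPoly

open Octonion Polynomial

/-- The constant term of the remainder of `f` modulo `w ^ 2 - t w + d`. -/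
noncomputable def remConst (t d : ℝ) (f : OctPoly) : Octonion :=
  f.sum fun i a => (quadraticPow t d i).1 • a

/-- The linear coefficient of the remainder of `f` modulo `w ^ 2 - t w + d`. -/
noncomputable def remLin (t d : ℝ) (f : OctPoly) : Octonion :=
  f.sum fun i a => (quadraticPow t d i).2 • a

theorem eval_eq_rem (f : OctPoly) (x : Octonion) :
    f.eval x = f.remConst (2 * x.re) x.normSq + x * f.remLin (2 * x.re) x.normSq := by
  simp only [eval, remConst, remLin, Finsupp.sum, Finset.mul_sum, ← Finset.sum_add_distrib]
  refine Finset.sum_congr rfl fun i _ => ?_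
  rw [x.pow_eq_quadraticPow, add_mul, ofReal_mul, smul_mul, mul_smul']

/-! ### Real polynomials among octonionic ones, and divisibility -/

/-- A real polynomial, viewed as an octonionic polynomial. -/
noncomputable def ofRealPoly : ℝ[X] →ₗ[ℝ] OctPoly :=
  Polynomial.lsum fun i => Finsupp.lsingle i ∘ₗ LinearMap.toSpanSingleton ℝ Octonion 1

/-- The polynomial of the real parts of the coefficients. -/
noncomputable def rePoly : OctPoly →ₗ[ℝ] ℝ[X] :=
  Finsupp.lsum ℝ fun i => Polynomial.monomial i ∘ₗ reₗ

@[simp] theorem ofRealPoly_monomial (i : ℕ) (r : ℝ) :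
    ofRealPoly (Polynomial.monomial i r) = monomial i (ofReal r) := by
  simp [ofRealPoly, Polynomial.lsum_apply, Polynomial.sum_monomial_index, monomial, ofReal]

@[simp] theorem rePoly_monomial (i : ℕ) (a : Octonion) :
    rePoly (monomial i a) = Polynomial.monomial i a.re := by
  simp [rePoly, monomial]

@[simp] theorem rePoly_ofRealPoly (p : ℝ[X]) : rePoly (ofRealPoly p) = p := by
  induction p using Polynomial.induction_on' with
  | add p q hp hq => simp [hp, hq]
  | monomial i r => simp

theorem add_mul (f g h : OctPoly) : mul (f + g) h = mul f h + mul g h :=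
  Finsupp.sum_add_index' (fun i => by simp [monomial]) fun i a b => by
    simp [monomial, _root_.add_mul, Finsupp.sum_add]

theorem mul_add (f g h : OctPoly) : mul f (g + h) = mul f g + mul f h := by
  simp only [mul]
  rw [← Finsupp.sum_add]
  refine Finset.sum_congr rfl fun i _ => ?_
  exact Finsupp.sum_add_index' (fun i => by simp [monomial]) fun i a b => by
    simp [monomial, _root_.mul_add]

theorem zero_mul (f : OctPoly) : mul 0 f = 0 := Finsupp.sum_zero_index

theorem mul_zero (f : OctPoly) : mul f 0 = 0 := by
  simp [mul]

@[simp] theorem monomial_mul_monomial (i j : ℕ) (a b : Octonion) :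
    mul (monomial i a) (monomial j b) = monomial (i + j) (a * b) := by
  simp [mul, monomial]

theorem ofRealPoly_mul (p q : ℝ[X]) : ofRealPoly (p * q) = mul (ofRealPoly p) (ofRealPoly q) := by
  induction p using Polynomial.induction_on' with
  | add p p' hp hq => rw [_root_.add_mul, map_add, map_add, hp, hq, add_mul]
  | monomial i r =>
    induction q using Polynomial.induction_on' with
    | add p q hp hq => rw [_root_.mul_add, map_add, map_add, hp, hq, mul_add]
    | monomial j s =>
      rw [Polynomial.monomial_mul_monomial]
      simp [ofReal_mul]
      simp [ofReal, mul_smul]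

theorem rePoly_ofRealPoly_mul (p : ℝ[X]) (f : OctPoly) :
    rePoly (mul (ofRealPoly p) f) = p * rePoly f := by
  induction p using Polynomial.induction_on' with
  | add p p' hp hq => rw [_root_.add_mul, map_add, add_mul, map_add, hp, hq]
  | monomial i r =>
    induction f using Finsupp.induction_linear with
    | zero => simp [mul_zero]
    | add f g hf hg => rw [mul_add, map_add, map_add, hf, hg, _root_.mul_add]
    | single j a =>
      change rePoly (mul _ (monomial j a)) = _ * rePoly (monomial j a)
      simp [ofReal_mul, Polynomial.monomial_mul_monomial]

/-- An octonionic quotient can be replaced by its real part, since multiplying by a real polynomial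
commutes with taking real parts of coefficients. -/
theorem ofRealPoly_dvd_iff (p q : ℝ[X]) : Divides (ofRealPoly p) (ofRealPoly q) ↔ p ∣ q := by
  constructor
  · rintro ⟨h, hh⟩
    refine ⟨rePoly h, ?_⟩
    rw [← rePoly_ofRealPoly_mul, ← hh, rePoly_ofRealPoly]
  · rintro ⟨r, rfl⟩
    exact ⟨ofRealPoly r, ofRealPoly_mul p r⟩

theorem ofRealPoly_pow (p : ℝ[X]) (s : ℕ) : pow (ofRealPoly p) s = ofRealPoly (p ^ s) := by
  induction s with
  | zero =>
    rw [pow_zero, ← Polynomial.monomial_zero_one, ofRealPoly_monomial]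
    simp [pow, ofReal]
  | succ s ih => rw [pow, ih, pow_succ, ofRealPoly_mul]

theorem conj_add (f g : OctPoly) : conj (f + g) = conj f + conj g :=
  Finsupp.mapRange_add star_add' f g

@[simp] theorem conj_monomial (i : ℕ) (a : Octonion) :
    conj (monomial i a) = monomial i (star a) := Finsupp.mapRange_single

theorem conj_zero : conj 0 = 0 := Finsupp.mapRange_zero

theorem conj_conj (f : OctPoly) : conj (conj f) = f := by
  ext1 i
  simp [conj, star_star']

theorem conj_mul (f g : OctPoly) : conj (mul f g) = mul (conj g) (conj f) := by
  induction f using Finsupp.induction_linear with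
  | zero => simp [zero_mul, mul_zero, conj_zero]
  | add f f' hf hf' => rw [add_mul, conj_add, conj_add, hf, hf', mul_add]
  | single i a =>
    induction g using Finsupp.induction_linear with
    | zero => simp [zero_mul, mul_zero, conj_zero]
    | add g g' hg hg' => rw [mul_add, conj_add, conj_add, hg, hg', add_mul]
    | single j b =>
      change conj (mul (monomial i a) (monomial j b)) = mul (conj (monomial j b)) (conj (monomial i a))
      simp [star_mul', add_comm]

theorem add_conj (f : OctPoly) : f + conj f = ofRealPoly ((2 : ℝ) • rePoly f) := by
  induction f using Finsupp.induction_linear with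
  | zero => simp [conj_zero]
  | add f f' hf hf' => rw [conj_add, map_add, smul_add, map_add, ← hf, ← hf']; abel
  | single i a =>
    change monomial i a + conj (monomial i a) = ofRealPoly ((2 : ℝ) • rePoly (monomial i a))
    rw [conj_monomial, rePoly_monomial, Polynomial.smul_monomial, ofRealPoly_monomial, smul_eq_mul,
      ← add_star_self]
    simp [monomial]

/-! ### The normal polynomial as a real polynomial -/

/-- The normal polynomial, with its coefficients viewed as real numbers. -/
noncomputable def realNormal (f : OctPoly) : ℝ[X] := rePoly (normal f)

/-- `N(f)` is its own conjugate, so its double is twice its real part. -/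
theorem ofRealPoly_realNormal (f : OctPoly) : ofRealPoly (realNormal f) = normal f := by
  have h : conj (normal f) = normal f := by rw [normal, conj_mul, conj_conj]
  have h2 := add_conj (normal f)
  rw [h, ← two_smul ℝ, map_smul] at h2
  exact (smul_right_injective _ (two_ne_zero (α := ℝ)) h2).symm

theorem realNormal_eq_sum (f : OctPoly) : realNormal f =
    f.sum fun i a => f.sum fun j b => Polynomial.monomial (i + j) (innerₗ a b) := by
  have h (i : ℕ) (a : Octonion) : (conj f).sum (fun j b => monomial (i + j) (a * b)) =
      f.sum fun j b => monomial (i + j) (a * star b) :=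
    Finsupp.sum_mapRange_index fun j => by simp [monomial]
  simp only [realNormal, normal, mul, h]
  simp only [Finsupp.sum, map_sum, rePoly_monomial, innerₗ_apply]

/-- Write `N(f)(z) = ∑ ⟨aᵢ, aⱼ⟩ zⁱ zʲ`, replace each power by its linear remainder and expand
bilinearly. -/
theorem aeval_realNormal (f : OctPoly) {z : ℂ} {t d : ℝ} (h : z ^ 2 = t * z - d) :
    aeval z (realNormal f) = ((remConst t d f).normSq : ℂ) +
      2 * (innerₗ (remConst t d f) (remLin t d f) : ℝ) * z + ((remLin t d f).normSq : ℝ) * z ^ 2 := by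
  have hl : aeval z (realNormal f) = ∑ i ∈ f.support, ∑ j ∈ f.support, (innerₗ (f i) (f j) : ℂ) *
      (((quadraticPow t d i).1 + (quadraticPow t d i).2 * z) *
        ((quadraticPow t d j).1 + (quadraticPow t d j).2 * z)) := by
    simp only [realNormal_eq_sum, Finsupp.sum, map_sum, aeval_monomial, pow_add,
      Complex.coe_algebraMap]
    simp only [pow_eq_quadraticPow h]
  have hs (p q : ℕ → ℝ) : (innerₗ (f.sum fun i a => p i • a) (f.sum fun i a => q i • a) : ℂ) =
      ∑ i ∈ f.support, ∑ j ∈ f.support, (innerₗ (f i) (f j) : ℂ) * (p i * q j) := by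
    simp only [Finsupp.sum, map_sum, LinearMap.sum_apply, map_smul, LinearMap.smul_apply,
      smul_eq_mul, Complex.ofReal_sum, Complex.ofReal_mul,
      Finset.mul_sum]
    rw [Finset.sum_comm]
    exact Finset.sum_congr rfl fun i _ => Finset.sum_congr rfl fun j _ => by ring
  -- Splitting the cross term into its two symmetric halves makes both sides agree term by term in
  -- `(i, j)`.
  have key : (2 : ℂ) * (innerₗ (remConst t d f) (remLin t d f) : ℝ) * z =
      (innerₗ (remConst t d f) (remLin t d f) : ℝ) * z +
        (innerₗ (remLin t d f) (remConst t d f) : ℝ) * z := by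
    rw [innerₗ_comm (remLin t d f)]; ring
  rw [key, hl, ← innerₗ_self, ← innerₗ_self]
  simp only [remConst, remLin, hs, Finset.sum_mul, ← Finset.sum_add_distrib]
  exact Finset.sum_congr rfl fun i _ => Finset.sum_congr rfl fun j _ => by ring

theorem coeff_realNormal_of_lt {f : OctPoly} {n : ℕ} (hf : f.HasDegree n) {k : ℕ}
    (hk : 2 * n < k) : (realNormal f).coeff k = 0 := by
  rw [realNormal_eq_sum, Finsupp.sum, finsetSum_coeff]
  refine Finset.sum_eq_zero fun i hi => ?_
  rw [Finsupp.sum, finsetSum_coeff]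
  refine Finset.sum_eq_zero fun j hj => ?_
  have hi' : i ≤ n := not_lt.1 fun h => Finsupp.mem_support_iff.1 hi (hf.2 i h)
  have hj' : j ≤ n := not_lt.1 fun h => Finsupp.mem_support_iff.1 hj (hf.2 j h)
  rw [Polynomial.coeff_monomial, if_neg (by omega)]

theorem coeff_realNormal_two_mul {f : OctPoly} {n : ℕ} (hf : f.HasDegree n) :
    (realNormal f).coeff (2 * n) = (f.coeff n).normSq := by
  rw [realNormal_eq_sum, Finsupp.sum, finsetSum_coeff]
  have hn : n ∈ f.support := Finsupp.mem_support_iff.2 hf.1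
  have hle {i : ℕ} (hi : i ∈ f.support) : i ≤ n :=
    not_lt.1 fun h => Finsupp.mem_support_iff.1 hi (hf.2 i h)
  rw [Finset.sum_eq_single_of_mem n hn, Finsupp.sum, finsetSum_coeff,
    Finset.sum_eq_single_of_mem n hn]
  · rw [Polynomial.coeff_monomial, if_pos (by omega), innerₗ_self, coeff]
  · intro j hj hjn
    rw [Polynomial.coeff_monomial, if_neg (by have := hle hj; omega)]
  · intro i hi hin
    rw [Finsupp.sum, finsetSum_coeff]
    refine Finset.sum_eq_zero fun j hj => ?_
    rw [Polynomial.coeff_monomial, if_neg (by have := hle hj; have := hle hi; omega)]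

theorem natDegree_realNormal {f : OctPoly} {n : ℕ} (hf : f.HasDegree n) :
    (realNormal f).natDegree = 2 * n :=
  natDegree_eq_of_le_of_coeff_ne_zero
    (natDegree_le_iff_coeff_eq_zero.2 fun _ hk => coeff_realNormal_of_lt hf hk)
    (by rw [coeff_realNormal_two_mul hf]; exact fun h => hf.1 (normSq_eq_zero.1 h))

theorem realNormal_ne_zero {f : OctPoly} {n : ℕ} (hf : f.HasDegree n) : realNormal f ≠ 0 := by
  intro h
  have := coeff_realNormal_two_mul hf
  rw [h, Polynomial.coeff_zero] at this
  exact hf.1 (normSq_eq_zero.1 this.symm)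

theorem eval_realNormal (f : OctPoly) (x : ℝ) :
    (realNormal f).eval x = (f.eval (ofReal x)).normSq := by
  have h := aeval_realNormal f (z := x) (t := 2 * x) (d := x ^ 2) (by push_cast; ring)
  rw [← Complex.coe_algebraMap, aeval_algebraMap_apply, Complex.coe_algebraMap] at h
  rw [eval_eq_rem, re_ofReal, normSq_ofReal, ofReal_mul, ← innerₗ_self]
  rw [← coe_aeval_eq_eval, Complex.ofReal_injective (h.trans (by push_cast; rfl) :
    ((aeval x (realNormal f) : ℝ) : ℂ) = ((remConst (2 * x) (x ^ 2) f).normSq +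
      2 * innerₗ (remConst (2 * x) (x ^ 2) f) (remLin (2 * x) (x ^ 2) f) * x +
      (remLin (2 * x) (x ^ 2) f).normSq * x ^ 2 : ℝ))]
  simp only [map_add, LinearMap.add_apply, map_smul, LinearMap.smul_apply, smul_eq_mul,
    innerₗ_self, innerₗ_comm (remLin _ _ f) (remConst _ _ f)]
  ring

end OctPoly

/-! ### Nonnegative real polynomials and conjugate pairs of roots -/

open Polynomial

namespace Polynomial

/-- The real quadratic polynomial with roots `z` and its complex conjugate. -/
noncomputable def conjQuadratic (z : ℂ) : ℝ[X] := X ^ 2 - C (2 * z.re) * X + C (‖z‖ ^ 2)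

theorem conjQuadratic_monic (z : ℂ) : (conjQuadratic z).Monic := by
  rw [conjQuadratic]; monicity!

theorem natDegree_conjQuadratic (z : ℂ) : (conjQuadratic z).natDegree = 2 := by
  rw [conjQuadratic]; compute_degree!

theorem map_conjQuadratic (z : ℂ) : (conjQuadratic z).map (algebraMap ℝ ℂ) =
    (X - C z) * (X - C (starRingEnd ℂ z)) := by
  have h1 : ((2 * z.re : ℝ) : ℂ) = z + starRingEnd ℂ z := by
    rw [Complex.add_conj]
  have h2 : ((‖z‖ ^ 2 : ℝ) : ℂ) = z * starRingEnd ℂ z := by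
    rw [Complex.mul_conj, Complex.normSq_eq_norm_sq]
  simp only [conjQuadratic, Polynomial.map_add, Polynomial.map_sub, Polynomial.map_mul,
    Polynomial.map_pow, map_X, map_C, Complex.coe_algebraMap, h1, h2]
  rw [C_add, C_mul]
  ring

theorem eval_conjQuadratic_nonneg (z : ℂ) (x : ℝ) : 0 ≤ (conjQuadratic z).eval x := by
  have : (conjQuadratic z).eval x = (x - z.re) ^ 2 + z.im ^ 2 := by
    simp [conjQuadratic, Complex.sq_norm, Complex.normSq_apply]; ring
  rw [this]; positivity

/-- In the closed upper half-plane `z = w̄` forces both to be real, hence equal; so over `ℂ` no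
linear factor is shared. -/
theorem isCoprime_conjQuadratic {z w : ℂ} (hz : 0 ≤ z.im) (hw : 0 ≤ w.im) (h : z ≠ w) :
    IsCoprime (conjQuadratic z) (conjQuadratic w) := by
  have h1 : z ≠ w := h
  have h2 : z ≠ starRingEnd ℂ w := fun e => h <| by
    have := congrArg Complex.im e
    have := congrArg Complex.re e
    simp at *
    apply Complex.ext <;> linarith
  have h3 : starRingEnd ℂ z ≠ w := fun e => h2 (by rw [← e, Complex.conj_conj])
  have h4 : starRingEnd ℂ z ≠ starRingEnd ℂ w := fun e => h ((starRingEnd ℂ).injective e)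
  have key {a b : ℂ} (hab : a ≠ b) : IsCoprime (X - C a) (X - C b) :=
    isCoprime_X_sub_C_of_isUnit_sub (sub_ne_zero.2 hab).isUnit
  rw [← isCoprime_map (algebraMap ℝ ℂ), map_conjQuadratic, map_conjQuadratic]
  exact ((key h1).mul_right (key h2)).mul_left ((key h3).mul_right (key h4))

/-- A real root is a minimum, so the derivative vanishes there too. -/
theorem sq_dvd_of_eval_nonneg {p : ℝ[X]} (hp : ∀ x, 0 ≤ p.eval x) {a : ℝ} (ha : p.eval a = 0) :
    (X - C a) ^ 2 ∣ p := by
  rcases eq_or_ne p 0 with rfl | h0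
  · exact dvd_zero _
  have hmin : IsLocalMin (fun x => p.eval x) a :=
    Filter.Eventually.of_forall fun x => by simpa [ha] using hp x
  have hd : p.derivative.eval a = 0 := by
    rw [← Polynomial.deriv]; exact hmin.deriv_eq_zero
  rw [← le_rootMultiplicity_iff h0]
  exact (one_lt_rootMultiplicity_iff_isRoot h0).2 ⟨ha, hd⟩

theorem conjQuadratic_dvd_of_eval_nonneg {p : ℝ[X]} (hp : ∀ x, 0 ≤ p.eval x) {z : ℂ}
    (hz : aeval z p = 0) : conjQuadratic z ∣ p := by
  by_cases h : z.im = 0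
  · obtain ⟨a, rfl⟩ : ∃ a : ℝ, z = a := ⟨z.re, Complex.ext rfl (by simpa using h)⟩
    have : conjQuadratic (a : ℂ) = (X - C a) ^ 2 := by
      have h2 : (C (2 * a) : ℝ[X]) = 2 * C a := by rw [C_mul]; rfl
      simp only [conjQuadratic, Complex.ofReal_re, h2, Complex.norm_real, Real.norm_eq_abs, sq_abs,
        C_pow]
      ring
    rw [this]
    refine sq_dvd_of_eval_nonneg hp ?_
    rw [← Complex.coe_algebraMap, aeval_algebraMap_apply] at hz
    simpa using hz
  · exact quadratic_dvd_of_aeval_eq_zero_im_ne_zero p hz h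

/-- Clear away from the finitely many roots of `q`, whose complement is dense; continuity does the
rest. -/
theorem eval_nonneg_of_mul {p q : ℝ[X]} (hq0 : q ≠ 0) (hq : ∀ x, 0 ≤ q.eval x)
    (hpq : ∀ x, 0 ≤ (q * p).eval x) (x : ℝ) : 0 ≤ p.eval x := by
  have hd : Dense ((q.roots.toFinset : Set ℝ)ᶜ) :=
    (Finset.countable_toSet _).dense_compl ℝ
  have hc : IsClosed {x : ℝ | 0 ≤ p.eval x} := isClosed_le continuous_const p.continuous
  have : closure ((q.roots.toFinset : Set ℝ)ᶜ) ⊆ {x : ℝ | 0 ≤ p.eval x} := by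
    refine hc.closure_subset_iff.2 fun y hy => ?_
    have hy' : q.eval y ≠ 0 := fun e => hy (by simp [hq0, e])
    have h1 : 0 < q.eval y := lt_of_le_of_ne (hq y) hy'.symm
    have h2 := hpq y
    rw [eval_mul] at h2
    exact nonneg_of_mul_nonneg_right h2 h1
  exact this (hd.closure_eq ▸ Set.mem_univ x)

theorem finiteMultiplicity_conjQuadratic {p : ℝ[X]} (hp : p ≠ 0) (z : ℂ) :
    FiniteMultiplicity (conjQuadratic z) p :=
  finiteMultiplicity_of_degree_pos_of_monic
    (natDegree_pos_iff_degree_pos.1 (by rw [natDegree_conjQuadratic]; norm_num))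
    (conjQuadratic_monic z) hp

/-- A nonzero polynomial that is nonnegative on the real line has twice as many roots as it has
conjugate pairs of roots, real roots counting for half a pair. -/
theorem natDegree_eq_two_mul_sum_multiplicity {p : ℝ[X]} (hp0 : p ≠ 0)
    (hp : ∀ x, 0 ≤ p.eval x) (S : Finset ℂ) (hS : ∀ z ∈ S, 0 ≤ z.im)
    (hroot : ∀ z : ℂ, 0 ≤ z.im → aeval z p = 0 → z ∈ S) :
    p.natDegree = 2 * ∑ z ∈ S, multiplicity (conjQuadratic z) p := by
  set q : ℝ[X] := ∏ z ∈ S, conjQuadratic z ^ multiplicity (conjQuadratic z) p with hq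
  have hqm : q.Monic := monic_prod_of_monic _ _ fun z _ => (conjQuadratic_monic z).pow _
  have hdvd : q ∣ p := by
    refine Finset.prod_dvd_of_coprime ?_ fun z _ => pow_multiplicity_dvd _ _
    intro z hz w hw hzw
    exact (isCoprime_conjQuadratic (hS z hz) (hS w hw) hzw).pow
  have hqnn (x : ℝ) : 0 ≤ q.eval x := by
    rw [hq, eval_prod]
    refine Finset.prod_nonneg fun z _ => ?_
    rw [eval_pow]
    exact pow_nonneg (eval_conjQuadratic_nonneg z x) _
  obtain ⟨r, hr⟩ := hdvd
  have hrnn := eval_nonneg_of_mul hqm.ne_zero hqnn (by rwa [← hr])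
  have hr0 : r ≠ 0 := fun h => hp0 (by rw [hr, h, mul_zero])
  -- The cofactor `r` is again nonnegative, so a root of `r` would yield one more factor
  -- `conjQuadratic z` of `p` than the multiplicity allows.
  have hrdeg : r.natDegree = 0 := by
    by_contra hne
    obtain ⟨z, hz⟩ := IsAlgClosed.exists_aeval_eq_zero ℂ r
      (fun h => hne (natDegree_eq_zero_iff_degree_le_zero.2 h.le))
    wlog him : 0 ≤ z.im generalizing z
    · refine this (starRingEnd ℂ z) ?_ (by simp; linarith)
      have := congrArg (starRingEnd ℂ) hz
      rwa [map_zero, ← Complex.conjAe_coe, ← aeval_algHom_apply] at this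
    have hzS : z ∈ S := hroot z him (by rw [hr, map_mul, hz, mul_zero])
    have h1 : conjQuadratic z ∣ r := conjQuadratic_dvd_of_eval_nonneg hrnn hz
    have h2 : conjQuadratic z ^ multiplicity (conjQuadratic z) p ∣ q :=
      Finset.dvd_prod_of_mem (fun z => conjQuadratic z ^ multiplicity (conjQuadratic z) p) hzS
    refine (finiteMultiplicity_conjQuadratic hp0 z).not_pow_dvd_of_multiplicity_lt
      (Nat.lt_succ_self _) ?_
    rw [pow_succ]
    exact (mul_dvd_mul h2 h1).trans hr.symm.dvd
  have hdeg : q.natDegree = 2 * ∑ z ∈ S, multiplicity (conjQuadratic z) p := by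
    rw [hq, natDegree_prod_of_monic _ _ fun z _ => (conjQuadratic_monic z).pow _, Finset.mul_sum]
    refine Finset.sum_congr rfl fun z _ => ?_
    rw [(conjQuadratic_monic z).natDegree_pow, natDegree_conjQuadratic, mul_comm]
  rw [hr, hqm.natDegree_mul' hr0, hrdeg, ← hr, hdeg, add_zero]

end Polynomial

/-! ### Spheres as points of the closed upper half-plane -/

namespace Octonion

/-- The point `Re x + i |Im x|` of the closed upper half-plane. -/
noncomputable def toComplex (x : Octonion) : ℂ := ⟨x.re, abs x.im⟩

theorem toComplex_im_nonneg (x : Octonion) : 0 ≤ x.toComplex.im := Real.sqrt_nonneg _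

theorem norm_toComplex_sq (x : Octonion) : ‖x.toComplex‖ ^ 2 = x.normSq := by
  rw [Complex.sq_norm, Complex.normSq_apply, toComplex, ← pow_two, ← pow_two, abs_sq, normSq_im]
  ring

theorem toComplex_eq_of {x : Octonion} {z : ℂ} (hz : 0 ≤ z.im) (hre : x.re = z.re)
    (hn : x.normSq = ‖z‖ ^ 2) : x.toComplex = z := by
  refine Complex.ext hre ?_
  rw [← norm_toComplex_sq, Complex.sq_norm, Complex.sq_norm, Complex.normSq_apply,
    Complex.normSq_apply, show x.toComplex.re = z.re from hre] at hn
  nlinarith [toComplex_im_nonneg x]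

theorem toComplex_sq (x : Octonion) :
    x.toComplex ^ 2 = ((2 * x.re : ℝ) : ℂ) * x.toComplex - (x.normSq : ℝ) := by
  rw [← norm_toComplex_sq, ← Complex.normSq_eq_norm_sq]
  apply Complex.ext
  · simp [pow_two, Complex.normSq_apply, toComplex]; ring
  · simp [pow_two, toComplex]; ring

/-- The imaginary part as a linear map. -/
noncomputable def imₗ : Octonion →ₗ[ℝ] Octonion :=
  LinearMap.id - LinearMap.toSpanSingleton ℝ Octonion 1 ∘ₗ reₗ

theorem imₗ_eq_zero_iff {x : Octonion} : imₗ x = 0 ↔ x.IsReal := by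
  have : imₗ x = x - ofReal x.re := rfl
  rw [this, sub_eq_zero]
  exact ⟨fun h => ⟨_, h⟩, IsReal.eq_ofReal_re⟩

end Octonion

/-! ### Zeros of `f` against roots of its normal polynomial -/

namespace OctPoly

open Octonion

theorem charPoly_eq (α : Octonion) : charPoly α = ofRealPoly (conjQuadratic α.toComplex) := by
  have h1 : (monomial 1 1 - monomial 0 α : OctPoly) = monomial 1 1 + monomial 0 (-α) := by
    simp [monomial, sub_eq_add_neg]
  have h2 : conjQuadratic α.toComplex = Polynomial.monomial 2 1 +
      Polynomial.monomial 1 (-(2 * α.re)) + Polynomial.monomial 0 α.normSq := by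
    rw [conjQuadratic, norm_toComplex_sq, ← C_mul_X_pow_eq_monomial, ← C_mul_X_pow_eq_monomial,
      ← C_mul_X_pow_eq_monomial, C_neg]
    simp [toComplex, sub_eq_add_neg]
  have h3 : star (1 : Octonion) = 1 := by ext1 <;> simp
  have h4 : star (-α) = -star α := by ext1 <;> simp
  have h5 : ofReal (-(2 * α.re)) = -star α + -α := by
    rw [← neg_add, add_comm, add_star_self, ofReal, ofReal, neg_smul]
  have h6 : ofReal (1 : ℝ) = 1 := one_smul _ _
  have h7 : -α * -star α = ofReal α.normSq := by rw [neg_mul_neg, mul_star_self]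
  rw [charPoly, h1, normal, conj_add, add_mul, mul_add, mul_add, h2, map_add, map_add]
  simp only [conj_monomial, monomial_mul_monomial, ofRealPoly_monomial, h3, h4, h5, h6, h7,
    one_mul, mul_one]
  simp only [monomial, Finsupp.single_add]
  abel

theorem isZeroOfMultiplicity_multiplicity {f : OctPoly} {n : ℕ} (hf : f.HasDegree n)
    {α : Octonion} (hα : α ∈ f.zeroSet) :
    f.IsZeroOfMultiplicity α (multiplicity (conjQuadratic α.toComplex) (realNormal f)) := by
  refine ⟨hα, ?_, ?_⟩
  · rw [charPoly_eq, ofRealPoly_pow, ← ofRealPoly_realNormal, ofRealPoly_dvd_iff]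
    exact pow_multiplicity_dvd _ _
  -- As `N(f) ≠ 0`, the multiplicity is finite and `multiplicity` is not its default value.
  · rw [charPoly_eq, ofRealPoly_pow, ← ofRealPoly_realNormal, ofRealPoly_dvd_iff]
    exact (finiteMultiplicity_conjQuadratic (realNormal_ne_zero hf)
      _).not_pow_dvd_of_multiplicity_lt (Nat.lt_succ_self _)

/-- Both points see the same remainder `A + w B`; subtracting gives `(x - y) B = 0`. -/
theorem rem_eq_zero_of_eval_eq_zero {f : OctPoly} {x y : Octonion} (hre : x.re = y.re)
    (hn : x.normSq = y.normSq) (hx : f.eval x = 0) (hy : f.eval y = 0) (hxy : x ≠ y) :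
    f.remConst (2 * x.re) x.normSq = 0 ∧ f.remLin (2 * x.re) x.normSq = 0 := by
  rw [eval_eq_rem] at hx hy
  rw [← hre, ← hn] at hy
  have h : (x - y) * f.remLin (2 * x.re) x.normSq = 0 := by
    rw [sub_mul, eq_neg_of_add_eq_zero_right hx, eq_neg_of_add_eq_zero_right hy, sub_self]
  have h0 := (eq_zero_or_eq_zero h).resolve_left (sub_ne_zero.2 hxy)
  rw [h0, MulZeroClass.mul_zero, add_zero] at hx
  exact ⟨hx, h0⟩

/-- From `A = -α B` follow `|A|² = |α|²|B|²` and `⟨A, B⟩ = -|B|² Re α`, so the value is `|B|²` times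
the quadratic of `α`, which vanishes at `α.toComplex`. -/
theorem aeval_realNormal_of_mem_zeroSet {f : OctPoly} {α : Octonion} (hα : α ∈ f.zeroSet) :
    aeval α.toComplex (realNormal f) = 0 := by
  have hα' : f.eval α = 0 := hα
  rw [eval_eq_rem] at hα'
  rw [aeval_realNormal f α.toComplex_sq, α.toComplex_sq]
  set A := remConst (2 * α.re) α.normSq f
  set B := remLin (2 * α.re) α.normSq f
  have hA : A = -(α * B) := eq_neg_of_add_eq_zero_left hα'
  have h1 : A.normSq = α.normSq * B.normSq := by rw [hA, normSq_neg, normSq_mul]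
  have h2 : innerₗ A B = -(B.normSq * α.re) := by
    rw [innerₗ_apply, hA, neg_mul, mul_mul_star_cancel, re_neg, re_smul]
  rw [h1, h2]
  push_cast
  ring

theorem exists_mem_zeroSet {f : OctPoly}
    (hrem : ∀ t d, ¬ (f.remConst t d = 0 ∧ f.remLin t d = 0)) {z : ℂ} (hz : 0 ≤ z.im)
    (hroot : aeval z (realNormal f) = 0) : ∃ α ∈ f.zeroSet, α.toComplex = z := by
  rcases hz.eq_or_lt with him | him
  · obtain ⟨a, rfl⟩ : ∃ a : ℝ, z = a := ⟨z.re, Complex.ext rfl (by simpa using him.symm)⟩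
    refine ⟨ofReal a, ?_, toComplex_eq_of hz (by simp) (by simp [normSq_ofReal])⟩
    rw [← Complex.coe_algebraMap, aeval_algebraMap_apply, Complex.coe_algebraMap,
      Complex.ofReal_eq_zero, coe_aeval_eq_eval, eval_realNormal, normSq_eq_zero] at hroot
    exact hroot
  · have hsq : z ^ 2 = ((2 * z.re : ℝ) : ℂ) * z - ((‖z‖ ^ 2 : ℝ) : ℂ) := by
      rw [← Complex.normSq_eq_norm_sq]
      apply Complex.ext
      · simp [pow_two, Complex.normSq_apply]; ring
      · simp [pow_two]; ring
    rw [aeval_realNormal f hsq] at hroot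
    set A := remConst (2 * z.re) (‖z‖ ^ 2) f with hA
    set B := remLin (2 * z.re) (‖z‖ ^ 2) f with hB
    have him' := congrArg Complex.im hroot
    have hre' := congrArg Complex.re hroot
    simp [pow_two] at him' hre'
    -- The imaginary part of the equation, divided by `Im z > 0`; the real part then gives `|A|²`.
    have h1 : innerₗ A B = -(B.normSq * z.re) := by
      refine mul_right_cancel₀ him.ne' ?_
      linarith
    have h2 : A.normSq = B.normSq * ‖z‖ ^ 2 := by
      rw [Complex.sq_norm, Complex.normSq_apply]
      rw [h1] at hre'
      linarith
    have hB0 : B ≠ 0 := fun h0 => hrem (2 * z.re) (‖z‖ ^ 2)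
      ⟨normSq_eq_zero.1 (by rw [← hA, h2, h0]; simp [normSq]), h0⟩
    have hBn : B.normSq ≠ 0 := fun h0 => hB0 (normSq_eq_zero.1 h0)
    have hαre : (-((B.normSq)⁻¹ • (A * star B))).re = z.re := by
      rw [re_neg, re_smul, ← innerₗ_apply, h1]
      field_simp
    have hαn : (-((B.normSq)⁻¹ • (A * star B))).normSq = ‖z‖ ^ 2 := by
      rw [normSq_neg, normSq_smul, normSq_mul, normSq_star, h2]
      field_simp
    -- This is `-A B⁻¹`, the only solution of `A + x B = 0`; the two relations above place it on the
    -- sphere of `z`.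
    refine ⟨-((B.normSq)⁻¹ • (A * star B)), ?_, toComplex_eq_of hz hαre hαn⟩
    change f.eval _ = 0
    rw [eval_eq_rem, hαre, hαn, ← hA, ← hB, neg_mul, smul_mul, mul_star_mul_cancel, smul_smul,
      inv_mul_cancel₀ hBn, one_smul, add_neg_cancel]

theorem injOn_toComplex {f : OctPoly}
    (hrem : ∀ t d, ¬ (f.remConst t d = 0 ∧ f.remLin t d = 0)) :
    Set.InjOn toComplex f.zeroSet := by
  intro x hx y hy hxy
  by_contra hne
  exact hrem _ _ (rem_eq_zero_of_eval_eq_zero (congrArg Complex.re hxy)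
    (by rw [← norm_toComplex_sq, hxy, norm_toComplex_sq]) hx hy hne)

theorem finite_zeroSet {f : OctPoly} (hN : realNormal f ≠ 0)
    (hrem : ∀ t d, ¬ (f.remConst t d = 0 ∧ f.remLin t d = 0)) : f.zeroSet.Finite := by
  refine Set.Finite.of_finite_image (f := toComplex) ?_ (injOn_toComplex hrem)
  refine ((realNormal f).rootSet_finite ℂ).subset ?_
  rintro _ ⟨α, hα, rfl⟩
  exact (mem_rootSet.2 ⟨hN, aeval_realNormal_of_mem_zeroSet hα⟩)

theorem sum_multiplicity {f : OctPoly} {n : ℕ} (hf : f.HasDegree n)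
    (hrem : ∀ t d, ¬ (f.remConst t d = 0 ∧ f.remLin t d = 0)) (hV : f.zeroSet.Finite) :
    ∑ α ∈ hV.toFinset, multiplicity (conjQuadratic α.toComplex) (realNormal f) = n := by
  classical
  have h := natDegree_eq_two_mul_sum_multiplicity (realNormal_ne_zero hf)
    (fun x => by rw [eval_realNormal]; exact normSq_nonneg _) (hV.toFinset.image toComplex)
    (fun z hz => by
      obtain ⟨α, -, rfl⟩ := Finset.mem_image.1 hz
      exact α.toComplex_im_nonneg)
    (fun z hz hroot => by
      obtain ⟨α, hα, rfl⟩ := exists_mem_zeroSet hrem hz hroot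
      exact Finset.mem_image_of_mem _ (hV.mem_toFinset.2 hα))
  rw [natDegree_realNormal hf, Finset.sum_image fun x hx y hy => injOn_toComplex hrem
    (hV.mem_toFinset.1 hx) (hV.mem_toFinset.1 hy)] at h
  omega

/-! ### Consequences of real higher coefficients -/

theorem imₗ_sum_smul {f : OctPoly} (hreal : ∀ i, 2 ≤ i → (f.coeff i).IsReal) (u : ℕ → ℝ) :
    imₗ (f.sum fun i a => u i • a) = u 0 • imₗ (f.coeff 0) + u 1 • imₗ (f.coeff 1) := by
  -- The support is enlarged by `{0, 1}` because `a₀` or `a₁` may vanish.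
  rw [Finsupp.sum_of_support_subset f (Finset.subset_union_right (s₁ := {0, 1})) _
    (fun i _ => smul_zero _), map_sum, ← Finset.sum_subset (Finset.subset_union_left)]
  · rw [Finset.sum_pair zero_ne_one, map_smul, map_smul, coeff, coeff]
  · intro i _ hi
    simp only [Finset.mem_insert, Finset.mem_singleton, not_or] at hi
    rw [map_smul, show imₗ (f i) = 0 from imₗ_eq_zero_iff.2 (hreal i (by omega)), smul_zero]

/-- Since `w⁰` and `w¹` are already reduced, the remainder has imaginary parts `Im a₀` and `Im a₁`.
-/
theorem isReal_of_rem_eq_zero {f : OctPoly} (hreal : ∀ i, 2 ≤ i → (f.coeff i).IsReal) {t d : ℝ}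
    (h : f.remConst t d = 0 ∧ f.remLin t d = 0) : (f.coeff 0).IsReal ∧ (f.coeff 1).IsReal := by
  have h1 := imₗ_sum_smul hreal fun i => (quadraticPow t d i).1
  have h2 := imₗ_sum_smul hreal fun i => (quadraticPow t d i).2
  rw [← remConst, h.1] at h1
  rw [← remLin, h.2] at h2
  simp only [quadraticPow, map_zero] at h1 h2
  rw [← imₗ_eq_zero_iff, ← imₗ_eq_zero_iff]
  constructor
  · simpa using h1.symm
  · simpa using h2.symm

theorem not_isSphericalZero {f : OctPoly}
    (hrem : ∀ t d, ¬ (f.remConst t d = 0 ∧ f.remLin t d = 0)) (α : Octonion) :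
    ¬ f.IsSphericalZero α := by
  rintro ⟨hα, hr, hc⟩
  refine hrem _ _ (rem_eq_zero_of_eval_eq_zero (re_star α).symm (normSq_star α).symm hα
    (hc (star_mem_conjClass hr)) fun h => hr ⟨_, eq_ofReal_re_of_star_eq h.symm⟩)

/-- At a real point the imaginary part of the value is `Im a₀`. -/
theorem not_isReal_of_mem_zeroSet {f : OctPoly} (hreal : ∀ i, 1 ≤ i → (f.coeff i).IsReal)
    (h0 : ¬ (f.coeff 0).IsReal) {α : Octonion} (hα : α ∈ f.zeroSet) : ¬ α.IsReal := by
  rintro ⟨x, rfl⟩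
  have h : f.eval (ofReal x) = 0 := hα
  rw [eval_eq_rem, ofReal_mul] at h
  have h' := congrArg imₗ h
  rw [map_add, map_smul, remConst, remLin, imₗ_sum_smul fun i hi => hreal i (by omega),
    imₗ_sum_smul fun i hi => hreal i (by omega), imₗ_eq_zero_iff.2 (hreal 1 le_rfl)] at h'
  simp only [quadraticPow, smul_zero, zero_smul, one_smul, add_zero, map_zero] at h'
  exact h0 (imₗ_eq_zero_iff.1 h')

end OctPoly

theorem corollary4p3 (f : OctPoly) (n : ℕ) (hn : 0 < n) (hf : f.HasDegree n) :
    (((∀ i, 1 ≤ i → i ≤ n → (f.coeff i).IsReal) ∧ ¬ (f.coeff 0).IsReal) →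
      ∀ α ∈ f.zeroSet, f.IsIsolatedZero α) ∧
    (((∀ i, 2 ≤ i → i ≤ n → (f.coeff i).IsReal) ∧
        (¬ (f.coeff 0).IsReal ∨ ¬ (f.coeff 1).IsReal)) →
      ∀ α, ¬ f.IsSphericalZero α) ∧
    ((((∀ i, 1 ≤ i → i ≤ n → (f.coeff i).IsReal) ∧ ¬ (f.coeff 0).IsReal) ∨
        ((∀ i, 2 ≤ i → i ≤ n → (f.coeff i).IsReal) ∧
          (¬ (f.coeff 0).IsReal ∨ ¬ (f.coeff 1).IsReal))) →
      ∃ (hV : f.zeroSet.Finite) (m : Octonion → ℕ),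
        (∀ α ∈ f.zeroSet, f.IsZeroOfMultiplicity α (m α)) ∧
        ∑ α ∈ hV.toFinset, m α = n) := by
  have hext {k : ℕ} (h : ∀ i, k ≤ i → i ≤ n → (f.coeff i).IsReal) :
      ∀ i, k ≤ i → (f.coeff i).IsReal := fun i hi => by
    rcases le_or_gt i n with hin | hin
    · exact h i hi hin
    · exact ⟨0, by rw [hf.2 i hin, Octonion.ofReal, zero_smul]⟩
  have hrem (h : (∀ i, 2 ≤ i → i ≤ n → (f.coeff i).IsReal) ∧
      (¬ (f.coeff 0).IsReal ∨ ¬ (f.coeff 1).IsReal)) (t d : ℝ) :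
      ¬ (f.remConst t d = 0 ∧ f.remLin t d = 0) := fun h0 => by
    have := OctPoly.isReal_of_rem_eq_zero (hext h.1) h0
    exact h.2.elim (· this.1) (· this.2)
  -- The first hypothesis is a special case of the second.
  have hcase (h : (∀ i, 1 ≤ i → i ≤ n → (f.coeff i).IsReal) ∧ ¬ (f.coeff 0).IsReal) :
      (∀ i, 2 ≤ i → i ≤ n → (f.coeff i).IsReal) ∧
        (¬ (f.coeff 0).IsReal ∨ ¬ (f.coeff 1).IsReal) :=
    ⟨fun i hi => h.1 i (by omega), Or.inl h.2⟩
  refine ⟨fun h α hα => ⟨hα, OctPoly.not_isReal_of_mem_zeroSet (hext h.1) h.2 hα,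
    OctPoly.not_isSphericalZero (hrem (hcase h)) α⟩,
    fun h α => OctPoly.not_isSphericalZero (hrem h) α, fun h => ?_⟩
  have h' := hrem (h.elim hcase id)
  have hV := OctPoly.finite_zeroSet (OctPoly.realNormal_ne_zero hf) h'
  exact ⟨hV, _, fun α hα => OctPoly.isZeroOfMultiplicity_multiplicity hf hα,
    OctPoly.sum_multiplicity hf h' hV⟩
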